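/- Let $n\ge 1$ and $d\ge 2$, and let $C\subseteq(\mathbb C^2)^{\otimes n}$ be an $((n,2,d))$ qubit code: a $2$-dimensional subspace that detects all Pauli errors of weight less than $d$. Let $2\mathrm I\subset \mathrm{SU}(2)$ be the binary icosahedral group, i.e. any $\mathrm{SU}(2)$-conjugate of the group of order $120$ generated by $-iX$, $-iZ$, $\mathsf F=\tfrac{e^{-i\pi/4}}{\sqrt2}\begin{pmatrix}1&-i\\1&i\end{pmatrix}$ and $\mathsf\Phi=\tfrac12\begin{pmatrix}\varphi+i\varphi^{-1}&1\\-1&\varphi-i\varphi^{-1}\end{pmatrix}$, where $\varphi=(1+\sqrt5)/2$. Suppose that $C$ implements $2\mathrm I$ transversally: for some isometric encoding $E:\mathbb C^2\to(\mathbb C^2)^{\otimes n}$ with range $C$, every $g\in 2\mathrm I$ admits $U_1,\dots,U_n\in \mathrm U(2)$ with $(U_1\otimes\cdots\otimes U_n)E=Eg$. Then $C$ is non-additive: it is not equivalent via non-entangling gates (products of single-qubit unitaries and permutations of the qubits) to any stabilizer code, i.e. to any simultaneous $+1$ eigenspace of a subgroup of the $n$-qubit Pauli group. -/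

import Mathlib

/-- The vector space `(ℂ²)^{⊗n}` of `n` qubits, in computational-basis coordinates. The Hermitian
inner product of `v` and `w` is `star v ⬝ᵥ w`. -/
abbrev QubitSpace (n : ℕ) : Type := (Fin n → Fin 2) → ℂ

/-- The tensor product `A₁ ⊗ ⋯ ⊗ Aₙ` of one-qubit operators, as a matrix in the computational
basis. -/
def tensorOp {n : ℕ} (A : Fin n → Matrix (Fin 2) (Fin 2) ℂ) :
    Matrix (Fin n → Fin 2) (Fin n → Fin 2) ℂ :=
  Matrix.of fun x y => ∏ i, A i (x i) (y i)

/-- The operator permuting the qubits by `σ`: it sends the basis vector `|y⟩` to `|y ∘ σ⟩`. -/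
def permOp {n : ℕ} (σ : Equiv.Perm (Fin n)) :
    Matrix (Fin n → Fin 2) (Fin n → Fin 2) ℂ :=
  Matrix.of fun x y => if x = y ∘ σ then 1 else 0

/-- The four one-qubit operators `I, X, Y, Z`, indexed by `0, 1, 2, 3`. -/
def pauli : Fin 4 → Matrix (Fin 2) (Fin 2) ℂ :=
  ![1, !![0, 1; 1, 0], !![0, -Complex.I; Complex.I, 0], !![1, 0; 0, -1]]

/-- The `n`-qubit Pauli operator with tensor factors `pauli (p i)`. -/
def pauliString {n : ℕ} (p : Fin n → Fin 4) : Matrix (Fin n → Fin 2) (Fin n → Fin 2) ℂ :=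
  tensorOp fun i => pauli (p i)

/-- The weight of a Pauli operator: the number of qubits on which it is not the identity. -/
def pauliWeight {n : ℕ} (p : Fin n → Fin 4) : ℕ :=
  (Finset.univ.filter fun i => p i ≠ 0).card

/-- `C` is an `((n, K, d))` quantum code: it has dimension `K` and detects (Knill-Laflamme) every
Pauli error of weight less than `d`, i.e. its distance is at least `d`. -/
structure IsQuantumCode {n : ℕ} (C : Submodule ℂ (QubitSpace n)) (K d : ℕ) : Prop where
  finrank_eq : Module.finrank ℂ C = K
  detects : ∀ p : Fin n → Fin 4, pauliWeight p < d →
    ∃ c : ℂ, ∀ v ∈ C, ∀ w ∈ C,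
      star v ⬝ᵥ (Matrix.mulVec (pauliString p) w) = c * (star v ⬝ᵥ w)

/-- `C` is a stabilizer code: the simultaneous `+1` eigenspace of a subgroup `S` of the `n`-qubit
Pauli group `{iᵏ P₁ ⊗ ⋯ ⊗ Pₙ}`. -/
def IsStabilizerCode {n : ℕ} (C : Submodule ℂ (QubitSpace n)) : Prop :=
  ∃ S : Subgroup (Matrix.unitaryGroup (Fin n → Fin 2) ℂ),
    (∀ s ∈ S, ∃ (k : ℕ) (p : Fin n → Fin 4),
      (s : Matrix (Fin n → Fin 2) (Fin n → Fin 2) ℂ) = Complex.I ^ k • pauliString p) ∧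
    ∀ v : QubitSpace n, v ∈ C ↔
      ∀ s ∈ S, Matrix.mulVec (s : Matrix (Fin n → Fin 2) (Fin n → Fin 2) ℂ) v = v

/-- `W` is non-entangling: a permutation of the qubits followed by a product of one-qubit
unitaries. -/
def IsNonEntangling {n : ℕ} (W : Matrix (Fin n → Fin 2) (Fin n → Fin 2) ℂ) : Prop :=
  ∃ (U : Fin n → Matrix.unitaryGroup (Fin 2) ℂ) (σ : Equiv.Perm (Fin n)),
    W = tensorOp (fun i => (U i : Matrix (Fin 2) (Fin 2) ℂ)) * permOp σ

/-- Two `n`-qubit codes are equivalent via non-entangling gates. -/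
def CodeEquivalent {n : ℕ} (C C' : Submodule ℂ (QubitSpace n)) : Prop :=
  ∃ W, IsNonEntangling W ∧ C.map (Matrix.mulVecLin W) = C'

/-- A code is non-additive if it is not equivalent via non-entangling gates to any stabilizer
code. -/
def IsNonAdditive {n : ℕ} (C : Submodule ℂ (QubitSpace n)) : Prop :=
  ¬ ∃ C' : Submodule ℂ (QubitSpace n), IsStabilizerCode C' ∧ CodeEquivalent C C'

/-- `E` is an encoding of one logical qubit with codespace `C`: an isometry `ℂ² → (ℂ²)^{⊗n}` with
range `C` (its columns are the logical basis vectors `|0_L⟩, |1_L⟩`). -/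
def IsEncoding {n : ℕ} (C : Submodule ℂ (QubitSpace n))
    (E : Matrix (Fin n → Fin 2) (Fin 2) ℂ) : Prop :=
  E.conjTranspose * E = 1 ∧ LinearMap.range (Matrix.mulVecLin E) = C

/-- The code `C` implements the group `G` of logical gates transversally: for some choice of
orthonormal logical basis, every `g ∈ G` is implemented on the codespace by some
`U₁ ⊗ ⋯ ⊗ Uₙ` with all `Uᵢ ∈ U(2)`. (For `n ≥ 1`, a global phase can be absorbed in `U₁`.) -/
def ImplementsTransversally {n : ℕ} (C : Submodule ℂ (QubitSpace n))
    (G : Subgroup (Matrix.specialUnitaryGroup (Fin 2) ℂ)) : Prop :=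
  ∃ E : Matrix (Fin n → Fin 2) (Fin 2) ℂ, IsEncoding C E ∧
    ∀ g ∈ G, ∃ U : Fin n → Matrix.unitaryGroup (Fin 2) ℂ,
      tensorOp (fun i => (U i : Matrix (Fin 2) (Fin 2) ℂ)) * E =
        E * (g : Matrix (Fin 2) (Fin 2) ℂ)

/-- The determinant-one Pauli gate `-iX`. -/
noncomputable def gateX : Matrix.specialUnitaryGroup (Fin 2) ℂ :=
  ⟨!![0, -Complex.I; -Complex.I, 0], by
    rw [Matrix.mem_specialUnitaryGroup_iff, Matrix.mem_unitaryGroup_iff]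
    refine ⟨?_, by simp [Matrix.det_fin_two]⟩
    ext i j
    fin_cases i <;> fin_cases j <;> simp [Matrix.mul_apply, Matrix.star_apply]⟩

/-- The determinant-one Pauli gate `-iZ`. -/
noncomputable def gateZ : Matrix.specialUnitaryGroup (Fin 2) ℂ :=
  ⟨!![-Complex.I, 0; 0, Complex.I], by
    rw [Matrix.mem_specialUnitaryGroup_iff, Matrix.mem_unitaryGroup_iff]
    refine ⟨?_, by simp [Matrix.det_fin_two]⟩
    ext i j
    fin_cases i <;> fin_cases j <;> simp [Matrix.mul_apply, Matrix.star_apply]⟩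

/-- The determinant-one facet gate `(e^{-iπ/4} / √2) [[1, -i], [1, i]]`; the scalar factor is
`(1 - i) / 2`. -/
noncomputable def gateF : Matrix.specialUnitaryGroup (Fin 2) ℂ :=
  ⟨((1 - Complex.I) / 2) • !![1, -Complex.I; 1, Complex.I], by
    have hI : Complex.I ^ 2 = -1 := Complex.I_sq
    have h2 : (starRingEnd ℂ) 2 = 2 := Complex.conj_ofNat 2
    rw [Matrix.mem_specialUnitaryGroup_iff, Matrix.mem_unitaryGroup_iff]
    constructor
    · ext i j
      fin_cases i <;> fin_cases j <;> simp [Matrix.mul_apply, Matrix.star_apply, h2] <;> grind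
    · simp [Matrix.det_fin_two]
      grind⟩

theorem phi_mem_specialUnitaryGroup (a : ℝ) (ha : a ≠ 0) (h : a ^ 2 = a + 1) :
    (1 / 2 : ℂ) • !![(a : ℂ) + Complex.I * (a : ℂ)⁻¹, 1; -1, (a : ℂ) - Complex.I * (a : ℂ)⁻¹] ∈
      Matrix.specialUnitaryGroup (Fin 2) ℂ := by
  have hI : Complex.I ^ 2 = -1 := Complex.I_sq
  have hc : (starRingEnd ℂ) 2 = 2 := Complex.conj_ofNat 2
  have h0 : (a : ℂ) ≠ 0 := by exact_mod_cast ha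
  have h1 : (a : ℂ) ^ 2 = a + 1 := by exact_mod_cast h
  have h2 : (a : ℂ)⁻¹ = a - 1 := by grind
  rw [h2, Matrix.mem_specialUnitaryGroup_iff, Matrix.mem_unitaryGroup_iff]
  constructor
  · ext i j
    fin_cases i <;> fin_cases j <;> simp [Matrix.mul_apply, Matrix.star_apply, hc] <;> grind
  · simp [Matrix.det_fin_two]
    grind

/-- The gate `Φ = (1/2) [[φ + iφ⁻¹, 1], [-1, φ - iφ⁻¹]]`, with `φ = (1 + √5)/2`. -/
noncomputable def gatePhi : Matrix.specialUnitaryGroup (Fin 2) ℂ :=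
  ⟨(1 / 2 : ℂ) •
      !![(Real.goldenRatio : ℂ) + Complex.I * (Real.goldenRatio : ℂ)⁻¹, 1;
        -1, (Real.goldenRatio : ℂ) - Complex.I * (Real.goldenRatio : ℂ)⁻¹],
    phi_mem_specialUnitaryGroup Real.goldenRatio Real.goldenRatio_ne_zero Real.goldenRatio_sq⟩

/-- The standard realization `⟨-iX, -iZ, F, Φ⟩` of the binary icosahedral group in `SU(2)`. -/
noncomputable def binaryIcosahedral : Subgroup (Matrix.specialUnitaryGroup (Fin 2) ℂ) :=
  Subgroup.closure {gateX, gateZ, gateF, gatePhi}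

/-- `G` is a realization of the binary icosahedral group `2I` in `SU(2)`: a conjugate of the
standard one. -/
def IsBinaryIcosahedral (G : Subgroup (Matrix.specialUnitaryGroup (Fin 2) ℂ)) : Prop :=
  ∃ h : Matrix.specialUnitaryGroup (Fin 2) ℂ,
    G = binaryIcosahedral.map (MulAut.conj h).toMonoidHom

/-!
A non-entangling gate turns an equivalence with a stabilizer code into an isometric encoding `E`
whose range is the stabilizer code, with the same transversal gates. Each Pauli operator commutes
or anticommutes with every stabilizer, so its compression to the code either vanishes or is an
honest logical operator of square one.

Take a logical operator `L p` that is not a scalar, with `p` of minimal weight and support `s`;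
since `2 ≤ d`, `s` has at least two sites. Conjugation by a transversal gate sends `L p` to a
combination of logical Pauli operators of support `s`. A one-qubit gate of nonzero trace that
conjugates `L p` into an operator commuting with `L p` commutes with `L p` itself, so two
noncommuting gates of nonzero trace force some `L q` with `q` of support `s` to anticommute with
`L p`. By minimality of the weight, two Pauli operators of support `s` with the same letter at some
site of `s` act proportionally. Hence `p`, `q` and their product have distinct letters at every site
of `s`, and they exhaust the Pauli operators of support `s` that do not act as zero.

The adjoint action of a transversal gate `g` in this basis is therefore a matrix with rows of norm
one whose entries are products of at least two coordinates of real unit vectors, and distinct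
entries of a row use distinct coordinates at every site of `s`. This forces each entry to be `0`,
`1` or `-1`. As `|tr g|² = 1 + tr (Ad g)`, the number `|tr g|²` is an integer, whereas `Φ` has trace
`φ` and `φ² = φ + 1` is irrational.
-/

open scoped Matrix

section AnticommutingInvolutions

theorem conj_mul_conj_self {G : Type*} [Monoid G] {a g h : G} (hgh : g * h = 1) (hhg : h * g = 1)
    (ha : a * a = 1) : h * a * g * (h * a * g) = 1 := by
  calc h * a * g * (h * a * g) = h * (a * (g * h) * a) * g := by simp only [mul_assoc]
    _ = 1 := by rw [hgh, mul_one, ha, mul_one, hhg]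

theorem pairwise_anticommute_of_anticommute {K R : Type*} [CommRing K] [Ring R] [Algebra K R]
    {a b : R} (hab : a * b = -(b * a)) (c : K) :
    Pairwise fun i j => ![a, b, c • (a * b)] i * ![a, b, c • (a * b)] j =
      -(![a, b, c • (a * b)] j * ![a, b, c • (a * b)] i) := by
  have hba : b * a = -(a * b) := by rw [hab, neg_neg]
  have hac : a * (a * b) = -(a * b * a) := by rw [mul_assoc a b, hba, mul_neg, neg_neg]
  have hbc : b * (a * b) = -(a * b * b) := by rw [← mul_assoc, hba, neg_mul]
  intro i j hij
  fin_cases i <;> fin_cases j <;> simp_all [← smul_neg]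

variable {K : Type*} [Field K] [CharZero K]

theorem disjoint_span_singleton_of_anticommute {R : Type*} [Ring R] [Algebra K R] {a b : R}
    (hb : b * b = 1) (hab : a * b = -(b * a)) : Disjoint (K ∙ a) (K ∙ b) := by
  simp only [Submodule.disjoint_def, Submodule.mem_span_singleton]
  rintro _ ⟨y, rfl⟩ ⟨z, hz⟩
  have hcomm : y • a * b = b * (y • a) := by
    rw [← hz, smul_mul_assoc, mul_smul_comm]
  have hanti : y • a * b = -(y • a * b) := by
    nth_rewrite 2 [hcomm]
    rw [smul_mul_assoc, mul_smul_comm, hab, smul_neg]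
  have htwo : (2 : K) • (y • a * b) = 0 := by
    rw [two_smul, ← eq_neg_iff_add_eq_zero, ← hanti]
  calc y • a = y • a * b * b := by rw [mul_assoc, hb, mul_one]
    _ = 0 := by rw [(smul_eq_zero_iff_right two_ne_zero).mp htwo, zero_mul]

theorem trace_eq_zero_of_anticommute {κ : Type*} [Fintype κ] [DecidableEq κ]
    {A B : Matrix κ κ K} (hB : B * B = 1) (hAB : A * B = -(B * A)) : A.trace = 0 := by
  refine self_eq_neg.mp ?_
  calc A.trace = (B * A * B).trace := by
        rw [Matrix.trace_mul_comm, ← mul_assoc, hB, one_mul]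
    _ = -(A * B * B).trace := by rw [hAB, neg_mul, Matrix.trace_neg, neg_neg]
    _ = -A.trace := by rw [mul_assoc, hB, mul_one]

theorem trace_mul_eq_ite_of_anticommute {ι κ : Type*} [DecidableEq ι] [Fintype κ] [DecidableEq κ]
    {M : ι → Matrix κ κ K} (hM : ∀ a, M a * M a = 1)
    (hanti : Pairwise fun a b => M a * M b = -(M b * M a)) (a b : ι) :
    (M a * M b).trace = if a = b then (Fintype.card κ : K) else 0 := by
  split_ifs with hab
  · rw [hab, hM, Matrix.trace_one]
  · have h := congrArg Matrix.trace (hanti hab)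
    rw [Matrix.trace_neg, Matrix.trace_mul_comm (M b)] at h
    exact self_eq_neg.mp h

end AnticommutingInvolutions

section TraceOrthogonality

variable {K ι κ : Type*} [Field K] [DecidableEq ι] [Fintype κ]
  {M : ι → Matrix κ κ K} {c : K}

theorem trace_sum_smul_mul [Fintype ι]
    (hM : ∀ a b, (M a * M b).trace = if a = b then c else 0) (x : ι → K) (b : ι) :
    ((∑ a, x a • M a) * M b).trace = x b * c := by
  simp [Finset.sum_mul, Matrix.trace_sum, hM]

theorem trace_sum_smul_mul_self [Fintype ι]
    (hM : ∀ a b, (M a * M b).trace = if a = b then c else 0)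
    (x : ι → K) :
    ((∑ a, x a • M a) * ∑ a, x a • M a).trace = (∑ a, x a ^ 2) * c := by
  rw [Finset.mul_sum, Matrix.trace_sum, Finset.sum_mul]
  refine Finset.sum_congr rfl fun b _ => ?_
  rw [mul_smul_comm, Matrix.trace_smul, trace_sum_smul_mul hM, smul_eq_mul]
  ring

theorem linearIndependent_of_trace_mul [Finite ι] (hc : c ≠ 0)
    (hM : ∀ a b, (M a * M b).trace = if a = b then c else 0) : LinearIndependent K M := by
  have := Fintype.ofFinite ι
  refine Fintype.linearIndependent_iff.mpr fun x hx b => ?_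
  have hb := trace_sum_smul_mul hM x b
  rw [hx, zero_mul, Matrix.trace_zero] at hb
  exact (mul_eq_zero.mp hb.symm).resolve_right hc

end TraceOrthogonality

theorem trace_mulLeft_comp_mulRight {K κ : Type*} [CommRing K] [Fintype κ]
    (A B : Matrix κ κ K) :
    LinearMap.trace K (Matrix κ κ K) (LinearMap.mulLeft K A ∘ₗ LinearMap.mulRight K B) =
      A.trace * B.trace := by
  classical
  rw [LinearMap.trace_eq_matrix_trace K (Matrix.stdBasis K κ κ), Matrix.trace,
    Fintype.sum_prod_type, Matrix.trace, Matrix.trace, Finset.sum_mul_sum]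
  refine Finset.sum_congr rfl fun i _ => Finset.sum_congr rfl fun j _ => ?_
  calc _ = (A * (Matrix.single i j 1 * B) : Matrix κ κ K) i j := by
        rw [Matrix.diag_apply, LinearMap.toMatrix_apply, Matrix.stdBasis_eq_single]
        rfl
    _ = A i i * B j j := by
        rw [← mul_assoc, Matrix.mul_apply,
          Finset.sum_eq_single j (by simp +contextual [Matrix.mul_single_apply_of_ne]) (by simp)]
        simp

section TwoByTwo

variable {K : Type*} [Field K] {M N X : Matrix (Fin 2) (Fin 2) K}

theorem mem_span_one_of_commute_of_not_commute (hM : M * X = X * M) (hN : N * X = X * N)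
    (hMN : M * N ≠ N * M) : X ∈ K ∙ (1 : Matrix (Fin 2) (Fin 2) K) := by
  rw [Submodule.mem_span_singleton]
  simp only [← Matrix.ext_iff, Fin.forall_fin_two, Matrix.mul_apply, Fin.sum_univ_two, Ne] at *
  refine ⟨X 0 0, ?_⟩
  simp only [Matrix.smul_apply, Matrix.one_apply_eq, smul_eq_mul, mul_one, true_and,
    Matrix.one_apply_ne (zero_ne_one : (0 : Fin 2) ≠ 1),
    Matrix.one_apply_ne (one_ne_zero : (1 : Fin 2) ≠ 0), mul_zero]
  grind

/-- Polarization of the Cayley-Hamilton identity `M * M = -det M • 1`. -/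
theorem mul_add_mul_comm_of_trace_eq_zero (hM : M.trace = 0) (hN : N.trace = 0) :
    M * N + N * M = (M * N).trace • (1 : Matrix (Fin 2) (Fin 2) K) := by
  rw [Matrix.trace_fin_two] at hM hN
  ext i j
  fin_cases i <;> fin_cases j <;> simp [Matrix.mul_apply, Matrix.trace_fin_two] <;> grind

variable [CharZero K]

theorem mem_span_of_commute_of_trace_eq_zero (hM : M.trace = 0) (hN : N.trace = 0)
    (hMM : M * M = 1) (hMN : M * N = N * M) : N ∈ K ∙ M := by
  have hscalar : (2 : K) • (M * N) = (M * N).trace • (1 : Matrix (Fin 2) (Fin 2) K) := by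
    rw [two_smul, ← mul_add_mul_comm_of_trace_eq_zero hM hN, hMN]
  refine Submodule.mem_span_singleton.mpr ⟨2⁻¹ * (M * N).trace, ?_⟩
  calc (2⁻¹ * (M * N).trace) • M = M * ((2 : K)⁻¹ • ((M * N).trace • 1)) := by
        rw [smul_smul, mul_smul_comm, mul_one]
    _ = M * (M * N) := by rw [← hscalar, inv_smul_smul₀ two_ne_zero]
    _ = N := by rw [← mul_assoc, hMM, one_mul]

theorem commute_of_commute_conj {g h : Matrix (Fin 2) (Fin 2) K} (hM : M.trace = 0)
    (hMM : M * M = 1) (hgh : g * h = 1) (hg : g.trace ≠ 0)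
    (hconj : M * (h * M * g) = h * M * g * M) : g * M = M * g := by
  have htr : (h * M * g).trace = 0 := by
    rw [Matrix.trace_mul_comm, ← mul_assoc, hgh, one_mul, hM]
  obtain ⟨c, hc⟩ := Submodule.mem_span_singleton.mp
    (mem_span_of_commute_of_trace_eq_zero hM htr hMM hconj)
  have hMg : M * g = c • (g * M) := by
    rw [← mul_smul_comm, hc, ← mul_assoc, ← mul_assoc, hgh, one_mul]
  have hc1 : c * g.trace = 1 * g.trace := by
    calc c * g.trace = (M * g * M).trace := by
          rw [hMg, smul_mul_assoc, mul_assoc, hMM, mul_one, Matrix.trace_smul, smul_eq_mul]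
      _ = 1 * g.trace := by rw [Matrix.trace_mul_comm, ← mul_assoc, hMM]; simp
  rw [hMg, mul_right_cancel₀ hg hc1, one_smul]

theorem trace_mul_trace_eq_one_add_sum {M : Fin 3 → Matrix (Fin 2) (Fin 2) K}
    (hM : ∀ a, M a * M a = 1) (hanti : Pairwise fun a b => M a * M b = -(M b * M a))
    {g h : Matrix (Fin 2) (Fin 2) K} (hgh : h * g = 1) {R : Fin 3 → Fin 3 → K}
    (hR : ∀ a, h * M a * g = ∑ b, R a b • M b) :
    h.trace * g.trace = 1 + ∑ a, R a a := by
  have hM0 : ∀ a, (M a).trace = 0 := fun a =>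
    have hne : a ≠ a + 1 := by decide +revert
    trace_eq_zero_of_anticommute (hM (a + 1)) (hanti hne)
  let v : Option (Fin 3) → Matrix (Fin 2) (Fin 2) K := fun o => o.elim 1 M
  have horth : ∀ o o', (v o * v o').trace = if o = o' then 2 else 0 := by
    rintro (_ | a) (_ | b) <;>
      simp [v, hM0, trace_mul_eq_ite_of_anticommute hM hanti]
  let e := basisOfLinearIndependentOfCardEqFinrank
    (linearIndependent_of_trace_mul two_ne_zero horth) (by simp [Module.finrank_matrix])
  have he : ⇑e = v := coe_basisOfLinearIndependentOfCardEqFinrank _ _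
  have hnone : e none = 1 := by rw [he]; rfl
  have hsome : ∀ a, e (some a) = M a := fun a => by rw [he]; rfl
  rw [← trace_mulLeft_comp_mulRight, LinearMap.trace_eq_matrix_trace K e, Matrix.trace,
    Fintype.sum_option]
  congr 1
  · simp only [Matrix.diag_apply, LinearMap.toMatrix_apply, LinearMap.comp_apply,
      LinearMap.mulRight_apply, LinearMap.mulLeft_apply, hnone, one_mul, hgh]
    rw [← hnone, e.repr_self, Finsupp.single_eq_same]
  · refine Finset.sum_congr rfl fun a _ => ?_
    simp only [Matrix.diag_apply, LinearMap.toMatrix_apply, LinearMap.comp_apply,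
      LinearMap.mulRight_apply, LinearMap.mulLeft_apply, hsome, ← mul_assoc, hR]
    simp [← hsome, Finsupp.single_apply]

end TwoByTwo

theorem conjTranspose_mul_self_mul {R ι κ l : Type*} [CommRing R] [StarRing R] [Fintype ι]
    [Fintype κ] [DecidableEq κ] [DecidableEq l] {A : Matrix ι κ R} {B : Matrix κ l R}
    (hA : Aᴴ * A = 1) (hB : Bᴴ * B = 1) : (A * B)ᴴ * (A * B) = 1 := by
  rw [Matrix.conjTranspose_mul, Matrix.mul_assoc, ← Matrix.mul_assoc Aᴴ, hA, Matrix.one_mul, hB]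

theorem eq_zero_or_eq_one_of_le_mul {R β : Type*} [CommRing R] [LinearOrder R]
    [IsStrictOrderedRing R] [Fintype β] {a c w : β → R} (ha0 : ∀ b, 0 ≤ a b) (hc0 : ∀ b, 0 ≤ c b)
    (ha : ∑ b, a b ≤ 1) (hc : ∑ b, c b ≤ 1) (hle : ∀ b, w b ≤ a b * c b) (hw : ∑ b, w b = 1)
    (b : β) : w b = 0 ∨ w b = 1 := by
  have ha1 : ∀ b, a b ≤ 1 := fun b =>
    (Finset.single_le_sum (fun b _ => ha0 b) (Finset.mem_univ b)).trans ha
  have hc1 : ∀ b, c b ≤ 1 := fun b =>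
    (Finset.single_le_sum (fun b _ => hc0 b) (Finset.mem_univ b)).trans hc
  have hwa : ∀ b ∈ Finset.univ, w b ≤ a b := fun b _ =>
    (hle b).trans (mul_le_of_le_one_right (ha0 b) (hc1 b))
  have hwc : ∀ b ∈ Finset.univ, w b ≤ c b := fun b _ =>
    (hle b).trans (mul_le_of_le_one_left (hc0 b) (ha1 b))
  have hwa' : w b = a b := (Finset.sum_eq_sum_iff_of_le hwa).mp
    ((Finset.sum_le_sum hwa).antisymm (ha.trans hw.ge)) b (Finset.mem_univ b)
  have hwc' : w b = c b := (Finset.sum_eq_sum_iff_of_le hwc).mp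
    ((Finset.sum_le_sum hwc).antisymm (hc.trans hw.ge)) b (Finset.mem_univ b)
  have hidem : w b * w b = w b := le_antisymm
    (mul_le_of_le_one_left (hwa'.symm ▸ ha0 b) (hwa'.symm ▸ ha1 b))
    ((hle b).trans_eq (by rw [← hwa', ← hwc']))
  exact IsIdempotentElem.iff_eq_zero_or_one.mp hidem

theorem exists_int_eq_prod_of_sum_sq_eq_one {R ι α β : Type*} [CommRing R] [LinearOrder R]
    [IsStrictOrderedRing R] [Fintype ι] [Fintype α] [Fintype β] {x : ι → α → R}
    (hx : ∀ k, ∑ r, x k r ^ 2 = 1) {u : β → ι → α} {i j : ι} (hij : i ≠ j)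
    (hi : Function.Injective (u · i)) (hj : Function.Injective (u · j))
    (hsum : ∑ b, (∏ k, x k (u b k)) ^ 2 = 1) (b : β) : ∃ z : ℤ, ∏ k, x k (u b k) = z := by
  classical
  have hcol : ∀ k, Function.Injective (u · k) → ∑ b, x k (u b k) ^ 2 ≤ 1 := fun k hk =>
    calc ∑ b, x k (u b k) ^ 2 = ∑ r ∈ Finset.univ.image (u · k), x k r ^ 2 :=
          (Finset.sum_image (f := fun r => x k r ^ 2) hk.injOn).symm
      _ ≤ ∑ r, x k r ^ 2 := Finset.sum_le_univ_sum_of_nonneg fun r => sq_nonneg _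
      _ = 1 := hx k
  have hle_one : ∀ k r, x k r ^ 2 ≤ 1 := fun k r => (hx k).le.trans' <|
    Finset.single_le_sum (fun r _ => sq_nonneg (x k r)) (Finset.mem_univ r)
  have hprod : ∀ b, (∏ k, x k (u b k)) ^ 2 ≤ x i (u b i) ^ 2 * x j (u b j) ^ 2 := fun b => by
    rw [← Finset.prod_pow, ← Finset.prod_pair (f := fun k => x k (u b k) ^ 2) hij]
    exact Finset.prod_le_prod_of_subset_of_le_one (Finset.subset_univ _)
      (fun k _ => sq_nonneg _) fun k _ _ => hle_one k _
  rcases eq_zero_or_eq_one_of_le_mul (fun b => sq_nonneg _) (fun b => sq_nonneg _)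
    (hcol i hi) (hcol j hj) hprod hsum b with h | h
  · exact ⟨0, by simpa using h⟩
  · rcases sq_eq_one_iff.mp h with h | h
    · exact ⟨1, by simpa using h⟩
    · exact ⟨-1, by simpa using h⟩

section TensorOp

variable {n : ℕ}

theorem tensorOp_mul (A B : Fin n → Matrix (Fin 2) (Fin 2) ℂ) :
    tensorOp A * tensorOp B = tensorOp fun i => A i * B i := by
  ext x y
  simp only [tensorOp, Matrix.mul_apply, Matrix.of_apply, Finset.prod_univ_sum,
    Fintype.piFinset_univ, Finset.prod_mul_distrib]

theorem tensorOp_one : tensorOp (fun _ : Fin n => (1 : Matrix (Fin 2) (Fin 2) ℂ)) = 1 := by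
  ext x y
  simp only [tensorOp, Matrix.of_apply, Matrix.one_apply, Finset.prod_ite_zero, funext_iff,
    Finset.mem_univ, true_imp_iff, Finset.prod_const_one]

theorem conjTranspose_tensorOp (A : Fin n → Matrix (Fin 2) (Fin 2) ℂ) :
    (tensorOp A)ᴴ = tensorOp fun i => (A i)ᴴ := by
  ext x y
  simp [tensorOp, Matrix.conjTranspose_apply]

theorem tensorOp_smul (c : Fin n → ℂ) (A : Fin n → Matrix (Fin 2) (Fin 2) ℂ) :
    tensorOp (fun i => c i • A i) = (∏ i, c i) • tensorOp A := by
  ext x y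
  simp [tensorOp, Finset.prod_mul_distrib]

theorem tensorOp_sum_smul {α : Type*} [Fintype α] (x : Fin n → α → ℂ)
    (P : α → Matrix (Fin 2) (Fin 2) ℂ) :
    tensorOp (fun i => ∑ r, x i r • P r) =
      ∑ r : Fin n → α, (∏ i, x i (r i)) • tensorOp fun i => P (r i) := by
  classical
  ext a b
  simp only [tensorOp, Matrix.of_apply, Matrix.sum_apply, Matrix.smul_apply,
    Finset.prod_univ_sum, Fintype.piFinset_univ, Finset.prod_mul_distrib, smul_eq_mul]

theorem tensorOp_single (x y : Fin n → Fin 2) :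
    tensorOp (fun i => Matrix.single (x i) (y i) (1 : ℂ)) = Matrix.single x y 1 := by
  ext a b
  simp only [tensorOp, Matrix.of_apply, Matrix.single_apply, Finset.prod_ite_zero]
  simp [funext_iff, forall_and]

theorem conjTranspose_tensorOp_mul_self (U : Fin n → Matrix.unitaryGroup (Fin 2) ℂ) :
    (tensorOp fun i => U i)ᴴ * (tensorOp fun i => U i) = 1 := by
  rw [conjTranspose_tensorOp, tensorOp_mul, ← tensorOp_one]
  exact congrArg tensorOp (funext fun i => (U i).2.1)

theorem permOp_mul_tensorOp (σ : Equiv.Perm (Fin n)) (A : Fin n → Matrix (Fin 2) (Fin 2) ℂ) :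
    permOp σ * tensorOp A = tensorOp (fun i => A (σ i)) * permOp σ := by
  ext x y
  have hcomp : ∀ z : Fin n → Fin 2, x = z ∘ σ ↔ z = x ∘ σ.symm := fun z =>
    eq_comm.trans (σ.eq_comp_symm z x).symm
  simp only [permOp, tensorOp, Matrix.mul_apply, Matrix.of_apply, hcomp, ite_mul, one_mul,
    zero_mul, mul_ite, mul_one, mul_zero, Finset.sum_ite_eq', Finset.mem_univ, if_true]
  rw [← Equiv.prod_comp σ]
  simp

theorem conjTranspose_permOp_mul_self (σ : Equiv.Perm (Fin n)) :
    (permOp σ)ᴴ * permOp σ = 1 := by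
  ext x y
  have hcomp : y ∘ σ = x ∘ σ ↔ x = y := σ.surjective.injective_comp_right.eq_iff.trans eq_comm
  simp [permOp, Matrix.mul_apply, Matrix.one_apply, apply_ite, hcomp]

end TensorOp

section Pauli

theorem pauli_zero : pauli 0 = 1 := rfl

theorem pauli_mul_self (a : Fin 4) : pauli a * pauli a = 1 := by
  fin_cases a <;> ext i j <;> fin_cases i <;> fin_cases j <;> simp [pauli]

theorem conjTranspose_pauli (a : Fin 4) : (pauli a)ᴴ = pauli a := by
  fin_cases a <;> ext i j <;> fin_cases i <;> fin_cases j <;>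
    simp [pauli, Matrix.conjTranspose_apply]

theorem exists_pauli_xor_eq_smul_mul (a b : Fin 4) :
    ∃ c : ℂ, c ≠ 0 ∧ pauli (a ^^^ b) = c • (pauli a * pauli b) := by
  refine ⟨!![1, 1, 1, 1; 1, 1, -Complex.I, Complex.I; 1, Complex.I, 1, -Complex.I;
    1, -Complex.I, Complex.I, 1] a b, ?_, ?_⟩
  · fin_cases a <;> fin_cases b <;> simp
  · fin_cases a <;> fin_cases b <;> ext i j <;> fin_cases i <;> fin_cases j <;>
      simp [pauli]

theorem pauli_mul_eq_units_smul (a b : Fin 4) :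
    ∃ ε : ℤˣ, pauli a * pauli b = ((ε : ℤ) : ℂ) • (pauli b * pauli a) := by
  by_cases h : a = 0 ∨ b = 0 ∨ a = b
  · exact ⟨1, by rcases h with rfl | rfl | rfl <;> simp [pauli]⟩
  · refine ⟨-1, ?_⟩
    fin_cases a <;> fin_cases b <;> simp at h <;> ext i j <;> fin_cases i <;> fin_cases j <;>
      simp [pauli]

theorem trace_pauli_mul (a b : Fin 4) :
    (pauli a * pauli b).trace = if a = b then 2 else 0 := by
  fin_cases a <;> fin_cases b <;> simp [pauli, Matrix.trace_fin_two, one_add_one_eq_two]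

theorem trace_pauli_of_ne_zero {a : Fin 4} (ha : a ≠ 0) : (pauli a).trace = 0 := by
  simpa [pauli_zero, ha] using trace_pauli_mul a 0

theorem eq_sum_trace_smul_pauli (A : Matrix (Fin 2) (Fin 2) ℂ) :
    A = ∑ r, ((A * pauli r).trace / 2) • pauli r := by
  ext i j
  fin_cases i <;> fin_cases j <;>
    simp [Fin.sum_univ_four, pauli, Matrix.trace_fin_two, Matrix.mul_apply] <;> grind [Complex.I_sq]

/-- The Pauli transfer matrix of conjugation by `U`: the coordinates of `Uᴴ * pauli p * U` in the
basis of Pauli matrices, which are real since this operator is Hermitian. -/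
noncomputable def pauliTransfer (U : Matrix (Fin 2) (Fin 2) ℂ) (p r : Fin 4) : ℝ :=
  ((Uᴴ * pauli p * U * pauli r).trace / 2).re

theorem conj_pauli_eq_sum (U : Matrix (Fin 2) (Fin 2) ℂ) (p : Fin 4) :
    Uᴴ * pauli p * U = ∑ r, (pauliTransfer U p r : ℂ) • pauli r := by
  have hreal : ∀ r, (pauliTransfer U p r : ℂ) = (Uᴴ * pauli p * U * pauli r).trace / 2 := by
    intro r
    refine Complex.conj_eq_iff_re.mp ?_
    rw [map_div₀, Complex.conj_ofNat, starRingEnd_apply, ← Matrix.trace_conjTranspose,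
      Matrix.conjTranspose_mul, Matrix.trace_mul_comm]
    simp only [Matrix.conjTranspose_mul, Matrix.conjTranspose_conjTranspose, conjTranspose_pauli,
      Matrix.mul_assoc]
  simp only [hreal, ← eq_sum_trace_smul_pauli]

theorem sum_pauliTransfer_sq (U : Matrix.unitaryGroup (Fin 2) ℂ) (p : Fin 4) :
    ∑ r, pauliTransfer U p r ^ 2 = 1 := by
  have hsq := conj_mul_conj_self U.2.2 U.2.1 (pauli_mul_self p)
  rw [Matrix.star_eq_conjTranspose] at hsq
  have h := trace_sum_smul_mul_self trace_pauli_mul fun r => (pauliTransfer U p r : ℂ)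
  rw [← conj_pauli_eq_sum, hsq, Matrix.trace_one, Fintype.card_fin] at h
  have h' : (2 : ℂ) = (∑ r, (pauliTransfer U p r : ℂ) ^ 2) * 2 := by exact_mod_cast h
  exact_mod_cast (mul_eq_right₀ two_ne_zero).mp h'.symm

theorem pauliTransfer_eq_zero (U : Matrix.unitaryGroup (Fin 2) ℂ) {p r : Fin 4}
    (h : ¬(r = 0 ↔ p = 0)) : pauliTransfer U p r = 0 := by
  have hU : (U : Matrix (Fin 2) (Fin 2) ℂ)ᴴ * U = 1 := U.2.1
  have hU' : (U : Matrix (Fin 2) (Fin 2) ℂ) * (U : Matrix (Fin 2) (Fin 2) ℂ)ᴴ = 1 := U.2.2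
  have htrace : ((U : Matrix (Fin 2) (Fin 2) ℂ)ᴴ * pauli p * U * pauli r).trace = 0 := by
    by_cases hp : p = 0
    · have hr : r ≠ 0 := fun hr => h ⟨fun _ => hp, fun _ => hr⟩
      rw [hp, pauli_zero, mul_one, hU, one_mul, trace_pauli_of_ne_zero hr]
    · have hr : r = 0 := by tauto
      rw [hr, pauli_zero, mul_one, mul_assoc, Matrix.trace_mul_comm, mul_assoc, hU', mul_one,
        trace_pauli_of_ne_zero hp]
  rw [pauliTransfer, htrace, zero_div, Complex.zero_re]

end Pauli

section PauliString

variable {n : ℕ}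

theorem exists_pauliString_xor_eq_smul_mul (p q : Fin n → Fin 4) :
    ∃ c : ℂ, c ≠ 0 ∧
      pauliString (fun i => p i ^^^ q i) = c • (pauliString p * pauliString q) := by
  choose c hc hxor using exists_pauli_xor_eq_smul_mul
  refine ⟨∏ i, c (p i) (q i), Finset.prod_ne_zero_iff.mpr fun i _ => hc _ _, ?_⟩
  simp only [pauliString, tensorOp_mul, hxor, tensorOp_smul]

theorem pauliString_mul_self (p : Fin n → Fin 4) : pauliString p * pauliString p = 1 := by
  simp only [pauliString, tensorOp_mul, pauli_mul_self, tensorOp_one]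

theorem pauliString_commute_or_anticommute (p q : Fin n → Fin 4) :
    pauliString p * pauliString q = pauliString q * pauliString p ∨
      pauliString p * pauliString q = -(pauliString q * pauliString p) := by
  choose ε hε using pauli_mul_eq_units_smul
  have h : pauliString p * pauliString q =
      (((∏ i, ε (p i) (q i) : ℤˣ) : ℤ) : ℂ) • (pauliString q * pauliString p) := by
    simp only [pauliString, tensorOp_mul]
    rw [funext fun i => hε (p i) (q i), tensorOp_smul]
    simp
  rcases Int.units_eq_one_or (∏ i, ε (p i) (q i)) with hsign | hsign
  · exact Or.inl (by simpa [hsign] using h)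
  · exact Or.inr (by simpa [hsign] using h)

theorem span_range_pauliString :
    Submodule.span ℂ (Set.range (pauliString (n := n))) = ⊤ := by
  refine (Submodule.eq_top_iff'.mpr fun A => ?_)
  rw [Matrix.matrix_eq_sum_single A]
  refine Submodule.sum_mem _ fun x _ => Submodule.sum_mem _ fun y _ => ?_
  rw [← mul_one (A x y), ← smul_eq_mul, ← Matrix.smul_single, ← tensorOp_single,
    funext fun i => eq_sum_trace_smul_pauli (Matrix.single (x i) (y i) 1), tensorOp_sum_smul]
  exact Submodule.smul_mem _ _ <| Submodule.sum_mem _ fun r _ =>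
    Submodule.smul_mem _ _ <| Submodule.subset_span ⟨r, rfl⟩

theorem conj_pauliString_eq_sum (U : Fin n → Matrix (Fin 2) (Fin 2) ℂ) (p : Fin n → Fin 4) :
    (tensorOp U)ᴴ * pauliString p * tensorOp U =
      ∑ r : Fin n → Fin 4, ((∏ i, pauliTransfer (U i) (p i) (r i) : ℝ) : ℂ) • pauliString r := by
  rw [pauliString, conjTranspose_tensorOp, tensorOp_mul, tensorOp_mul]
  simp only [conj_pauli_eq_sum, tensorOp_sum_smul, Complex.ofReal_prod, pauliString]

theorem support_eq_of_prod_pauliTransfer_ne_zero {U : Fin n → Matrix.unitaryGroup (Fin 2) ℂ}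
    {p r : Fin n → Fin 4} (h : ∏ i, pauliTransfer (U i) (p i) (r i) ≠ 0) :
    Function.support r = Function.support p := by
  ext i
  by_contra hi
  exact h (Finset.prod_eq_zero (Finset.mem_univ i)
    (pauliTransfer_eq_zero (U i) (mt not_congr hi)))

theorem conj_permOp_pauliString (σ : Equiv.Perm (Fin n)) (p : Fin n → Fin 4) :
    (permOp σ)ᴴ * pauliString p * permOp σ = pauliString (p ∘ σ.symm) := by
  have h : pauliString p * permOp σ = permOp σ * pauliString (p ∘ σ.symm) := by
    simp [pauliString, permOp_mul_tensorOp]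
  rw [mul_assoc, h, ← mul_assoc, conjTranspose_permOp_mul_self, one_mul]

theorem pauliWeight_eq_ncard_support (p : Fin n → Fin 4) :
    pauliWeight p = (Function.support p).ncard := by
  rw [pauliWeight, ← Set.ncard_coe_finset]
  simp [Function.support]

theorem pauliWeight_comp_perm (p : Fin n → Fin 4) (σ : Equiv.Perm (Fin n)) :
    pauliWeight (p ∘ σ) = pauliWeight p := by
  rw [pauliWeight_eq_ncard_support, pauliWeight_eq_ncard_support,
    Function.support_comp_eq_preimage]
  exact Set.ncard_preimage_of_injective_subset_range σ.injective (by simp)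

end PauliString

section LogicalPauli

variable {n : ℕ} {κ : Type*} [Fintype κ]

/-- The compression of a Pauli operator to the codespace of the encoding `E`, as a logical
operator. -/
def logicalPauli (E : Matrix (Fin n → Fin 2) κ ℂ) (p : Fin n → Fin 4) : Matrix κ κ ℂ :=
  Eᴴ * pauliString p * E

/-- The logical gate `g` is implemented by a product of one-qubit unitaries. -/
def IsTransversalGate (E : Matrix (Fin n → Fin 2) κ ℂ) (g : Matrix κ κ ℂ) : Prop :=
  ∃ U : Fin n → Matrix.unitaryGroup (Fin 2) ℂ, tensorOp (fun i => U i) * E = E * g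

variable {E : Matrix (Fin n → Fin 2) κ ℂ} {g : Matrix κ κ ℂ} {p q r : Fin n → Fin 4}

theorem conj_logicalPauli_eq_sum {U : Fin n → Matrix (Fin 2) (Fin 2) ℂ}
    (hU : tensorOp U * E = E * g) (p : Fin n → Fin 4) :
    gᴴ * logicalPauli E p * g =
      ∑ r : Fin n → Fin 4,
        ((∏ i, pauliTransfer (U i) (p i) (r i) : ℝ) : ℂ) • logicalPauli E r := by
  calc gᴴ * logicalPauli E p * g = (E * g)ᴴ * pauliString p * (E * g) := by
        simp only [logicalPauli, Matrix.conjTranspose_mul, Matrix.mul_assoc]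
    _ = Eᴴ * ((tensorOp U)ᴴ * pauliString p * tensorOp U) * E := by
        rw [← hU]
        simp only [Matrix.conjTranspose_mul, Matrix.mul_assoc]
    _ = _ := by
        rw [conj_pauliString_eq_sum, Matrix.mul_sum, Matrix.sum_mul]
        simp only [Matrix.mul_smul, Matrix.smul_mul, logicalPauli]

variable [DecidableEq κ]

/-- An isometric encoding for which every Pauli operator either preserves the codespace or maps it
into its orthogonal complement, as is the case for stabilizer codes. -/
structure IsPauliEncoding (E : Matrix (Fin n → Fin 2) κ ℂ) : Prop where
  isometry : Eᴴ * E = 1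
  dichotomy : ∀ p, logicalPauli E p = 0 ∨ pauliString p * E = E * logicalPauli E p

theorem mem_span_one_of_commute_logicalPauli (hE : Eᴴ * E = 1) {X : Matrix κ κ ℂ}
    (hX : ∀ p, logicalPauli E p * X = X * logicalPauli E p) : X ∈ ℂ ∙ (1 : Matrix κ κ ℂ) := by
  have hcompression : ∀ A ∈ Submodule.span ℂ (Set.range (pauliString (n := n))),
      Eᴴ * A * E * X = X * (Eᴴ * A * E) := fun A hA => by
    induction hA using Submodule.span_induction with
    | mem A hA =>
      obtain ⟨p, rfl⟩ := hA
      exact hX p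
    | zero => simp
    | add A B _ _ hA hB => simp only [mul_add, add_mul, Matrix.mul_add, Matrix.add_mul, hA, hB]
    | smul c A _ hA => simp only [Matrix.mul_smul, Matrix.smul_mul, hA]
  have hall : ∀ B : Matrix κ κ ℂ, Commute B X := fun B => by
    have hB : Eᴴ * (E * B * Eᴴ) * E = B := by
      rw [Matrix.mul_assoc E, ← Matrix.mul_assoc, hE, Matrix.one_mul, Matrix.mul_assoc, hE,
        Matrix.mul_one]
    have h := hcompression (E * B * Eᴴ) (by simp [span_range_pauliString])
    rwa [hB] at h
  obtain ⟨c, hc⟩ := Matrix.mem_range_scalar_of_commute_single fun i j _ => hall _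
  exact Submodule.mem_span_singleton.mpr ⟨c, by rw [← hc, Matrix.smul_one_eq_diagonal]; rfl⟩

theorem IsTransversalGate.conjTranspose_mul_self (hg : IsTransversalGate E g) (hE : Eᴴ * E = 1) :
    gᴴ * g = 1 := by
  obtain ⟨U, hU⟩ := hg
  calc gᴴ * g = gᴴ * (Eᴴ * E) * g := by rw [hE, mul_one]
    _ = (tensorOp (fun i => U i) * E)ᴴ * (tensorOp (fun i => U i) * E) := by
        rw [hU, Matrix.conjTranspose_mul]
        simp only [Matrix.mul_assoc]
    _ = 1 := conjTranspose_mul_self_mul (conjTranspose_tensorOp_mul_self U) hE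

namespace IsPauliEncoding

theorem preserves (hE : IsPauliEncoding E) (hp : logicalPauli E p ≠ 0) :
    pauliString p * E = E * logicalPauli E p :=
  (hE.dichotomy p).resolve_left hp

theorem logicalPauli_mul (hE : IsPauliEncoding E) (hq : logicalPauli E q ≠ 0) :
    logicalPauli E p * logicalPauli E q = Eᴴ * (pauliString p * pauliString q) * E := by
  calc logicalPauli E p * logicalPauli E q = Eᴴ * pauliString p * (E * logicalPauli E q) := by
        rw [← Matrix.mul_assoc]
        rfl
    _ = Eᴴ * (pauliString p * pauliString q) * E := by
        rw [← hE.preserves hq]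
        simp only [Matrix.mul_assoc]

theorem logicalPauli_mul_self (hE : IsPauliEncoding E) (hp : logicalPauli E p ≠ 0) :
    logicalPauli E p * logicalPauli E p = 1 := by
  rw [hE.logicalPauli_mul hp, pauliString_mul_self, Matrix.mul_one, hE.isometry]

theorem exists_logicalPauli_xor_eq_smul_mul (hE : IsPauliEncoding E)
    (hq : logicalPauli E q ≠ 0) (p : Fin n → Fin 4) :
    ∃ c : ℂ, c ≠ 0 ∧
      logicalPauli E (fun i => p i ^^^ q i) = c • (logicalPauli E p * logicalPauli E q) := by
  obtain ⟨c, hc, hxor⟩ := exists_pauliString_xor_eq_smul_mul p q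
  refine ⟨c, hc, ?_⟩
  rw [hE.logicalPauli_mul hq, logicalPauli, hxor, Matrix.mul_smul, Matrix.smul_mul]

theorem commute_or_anticommute (hE : IsPauliEncoding E) (p q : Fin n → Fin 4) :
    logicalPauli E p * logicalPauli E q = logicalPauli E q * logicalPauli E p ∨
      logicalPauli E p * logicalPauli E q = -(logicalPauli E q * logicalPauli E p) := by
  by_cases hp : logicalPauli E p = 0
  · simp [hp]
  by_cases hq : logicalPauli E q = 0
  · simp [hq]
  rw [hE.logicalPauli_mul hp, hE.logicalPauli_mul hq]
  refine (pauliString_commute_or_anticommute p q).imp (fun h => by rw [h]) fun h => ?_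
  rw [h, Matrix.mul_neg, Matrix.neg_mul]

theorem trace_eq_zero_of_notMem_span_one (hE : IsPauliEncoding E)
    (hp : logicalPauli E p ∉ ℂ ∙ (1 : Matrix κ κ ℂ)) : (logicalPauli E p).trace = 0 := by
  obtain ⟨q, hq⟩ : ∃ q,
      logicalPauli E q * logicalPauli E p ≠ logicalPauli E p * logicalPauli E q := by
    by_contra! h
    exact hp (mem_span_one_of_commute_logicalPauli hE.isometry h)
  have hq0 : logicalPauli E q ≠ 0 := fun h => hq (by rw [h, zero_mul, mul_zero])
  exact trace_eq_zero_of_anticommute (hE.logicalPauli_mul_self hq0)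
    ((hE.commute_or_anticommute p q).resolve_left hq.symm)

theorem exists_logicalPauli_notMem_span_one [Nontrivial κ] (hE : IsPauliEncoding E) :
    ∃ p, logicalPauli E p ∉ ℂ ∙ (1 : Matrix κ κ ℂ) := by
  by_contra! hscalar
  obtain ⟨i, j, hij⟩ := exists_pair_ne κ
  have hsingle : Matrix.single i j 1 ∈ ℂ ∙ (1 : Matrix κ κ ℂ) :=
    mem_span_one_of_commute_logicalPauli hE.isometry fun p => by
      obtain ⟨c, hc⟩ := Submodule.mem_span_singleton.mp (hscalar p)
      rw [← hc, smul_one_mul, mul_smul_one]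
  obtain ⟨c, hc⟩ := Submodule.mem_span_singleton.mp hsingle
  simpa [hij] using congrFun (congrFun hc i) j

theorem mem_span_singleton_of_apply_eq (hE : IsPauliEncoding E)
    (hmin : ∀ q, pauliWeight q < pauliWeight p → logicalPauli E q ∈ ℂ ∙ (1 : Matrix κ κ ℂ))
    (hp : logicalPauli E p ≠ 0) (hr : Function.support r = Function.support p) {j : Fin n}
    (hj : p j ≠ 0) (hrj : r j = p j) : logicalPauli E r ∈ ℂ ∙ logicalPauli E p := by
  have hxor : ∀ {a b : Fin 4}, a ^^^ b ≠ 0 ↔ a ≠ b := by decide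
  have hlt : pauliWeight (fun i => r i ^^^ p i) < pauliWeight p := by
    rw [pauliWeight_eq_ncard_support, pauliWeight_eq_ncard_support]
    refine Set.ncard_lt_ncard (Set.ssubset_iff_exists.mpr ⟨fun i hi => ?_, j, hj, ?_⟩)
    · by_contra hpi
      have hri : i ∉ Function.support r := hr ▸ hpi
      rw [Function.notMem_support] at hpi hri
      exact hxor.mp hi (hri.trans hpi.symm)
    · exact fun h => hxor.mp h hrj
  obtain ⟨c, hc, hmul⟩ := hE.exists_logicalPauli_xor_eq_smul_mul hp r
  obtain ⟨z, hz⟩ := Submodule.mem_span_singleton.mp (hmin _ hlt)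
  refine Submodule.mem_span_singleton.mpr ⟨c⁻¹ * z, ?_⟩
  calc (c⁻¹ * z) • logicalPauli E p = (c⁻¹ • z • (1 : Matrix κ κ ℂ)) * logicalPauli E p := by
        rw [smul_smul, smul_one_mul]
    _ = logicalPauli E r * logicalPauli E p * logicalPauli E p := by
        rw [hz, hmul, inv_smul_smul₀ hc]
    _ = logicalPauli E r := by rw [mul_assoc, hE.logicalPauli_mul_self hp, mul_one]

theorem disjoint_span_singleton (hE : IsPauliEncoding E) (hq : logicalPauli E q ≠ 0)
    (hpq : logicalPauli E p * logicalPauli E q = -(logicalPauli E q * logicalPauli E p)) :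
    Disjoint (ℂ ∙ logicalPauli E p) (ℂ ∙ logicalPauli E q) :=
  disjoint_span_singleton_of_anticommute (hE.logicalPauli_mul_self hq) hpq

end IsPauliEncoding

end LogicalPauli

section LogicalPauliTriple

variable {n : ℕ} {κ : Type*} [Fintype κ] [DecidableEq κ] {E : Matrix (Fin n → Fin 2) κ ℂ}
  {g : Matrix κ κ ℂ} {p : Fin n → Fin 4} {s : Set (Fin n)} {u : Fin 3 → Fin n → Fin 4}

/-- Three Pauli operators with common support `s` that act as pairwise anticommuting logical
operators, where `s` is so small that every Pauli operator of weight less than `s.ncard` acts as a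
scalar. -/
structure IsMinimalLogicalTriple (E : Matrix (Fin n → Fin 2) κ ℂ) (s : Set (Fin n))
    (u : Fin 3 → Fin n → Fin 4) : Prop where
  support_eq : ∀ a, Function.support (u a) = s
  ne_zero : ∀ a, logicalPauli E (u a) ≠ 0
  anticommute : Pairwise fun a b =>
    logicalPauli E (u a) * logicalPauli E (u b) = -(logicalPauli E (u b) * logicalPauli E (u a))
  mem_span_one : ∀ q, pauliWeight q < s.ncard →
    logicalPauli E q ∈ ℂ ∙ (1 : Matrix κ κ ℂ)

namespace IsMinimalLogicalTriple

theorem mem_span_singleton_of_apply_eq (hu : IsMinimalLogicalTriple E s u)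
    (hE : IsPauliEncoding E) {r : Fin n → Fin 4} (hr : Function.support r = s) {k : Fin n}
    (hk : k ∈ s) {a : Fin 3} (hrk : r k = u a k) : logicalPauli E r ∈ ℂ ∙ logicalPauli E (u a) := by
  have hs := hu.support_eq a
  refine hE.mem_span_singleton_of_apply_eq (fun q hq => hu.mem_span_one q ?_) (hu.ne_zero a)
    (hr.trans hs.symm) (hs ▸ hk : k ∈ Function.support (u a)) hrk
  rwa [pauliWeight_eq_ncard_support (u a), hs] at hq

theorem eq_of_mem_span_singleton (hu : IsMinimalLogicalTriple E s u) (hE : IsPauliEncoding E)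
    {A : Matrix κ κ ℂ} (hA : A ≠ 0) {a b : Fin 3}
    (ha : A ∈ ℂ ∙ logicalPauli E (u a)) (hb : A ∈ ℂ ∙ logicalPauli E (u b)) : a = b := by
  by_contra hab
  exact hA (Submodule.disjoint_def.mp
    (hE.disjoint_span_singleton (hu.ne_zero b) (hu.anticommute hab)) A ha hb)

theorem apply_injective (hu : IsMinimalLogicalTriple E s u) (hE : IsPauliEncoding E) {k : Fin n}
    (hk : k ∈ s) : Function.Injective (u · k) := fun a _ hab =>
  hu.eq_of_mem_span_singleton hE (hu.ne_zero a) (Submodule.mem_span_singleton_self _)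
    (hu.mem_span_singleton_of_apply_eq hE (hu.support_eq a) hk hab)

theorem exists_apply_eq (hu : IsMinimalLogicalTriple E s u) (hE : IsPauliEncoding E) {k : Fin n}
    (hk : k ∈ s) {c : Fin 4} (hc : c ≠ 0) : ∃ a, u a k = c := by
  have hne : ∀ a, u a k ≠ 0 := fun a => Function.mem_support.mp (hu.support_eq a ▸ hk)
  have hinj : Function.Injective fun a => (⟨u a k, hne a⟩ : {c : Fin 4 // c ≠ 0}) :=
    fun a b hab => hu.apply_injective hE hk (congrArg Subtype.val hab)
  have hbij := (Fintype.bijective_iff_injective_and_card _).mpr ⟨hinj, by decide⟩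
  obtain ⟨a, ha⟩ := hbij.surjective ⟨c, hc⟩
  exact ⟨a, congrArg Subtype.val ha⟩

theorem mem_range_of_support_eq (hu : IsMinimalLogicalTriple E s u) (hE : IsPauliEncoding E)
    (hs : s.Nonempty) {r : Fin n → Fin 4} (hrs : Function.support r = s)
    (hr : logicalPauli E r ≠ 0) : r ∈ Set.range u := by
  have hletter : ∀ k ∈ s, ∃ a, u a k = r k := fun k hk =>
    hu.exists_apply_eq hE hk (Function.mem_support.mp (hrs ▸ hk))
  obtain ⟨k, hk⟩ := hs
  obtain ⟨a, ha⟩ := hletter k hk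
  refine ⟨a, funext fun j => ?_⟩
  by_cases hj : j ∈ s
  · obtain ⟨b, hb⟩ := hletter j hj
    rw [hu.eq_of_mem_span_singleton hE hr (hu.mem_span_singleton_of_apply_eq hE hrs hk ha.symm)
      (hu.mem_span_singleton_of_apply_eq hE hrs hj hb.symm), hb]
  · have huj : u a j = 0 := Function.notMem_support.mp (hu.support_eq a ▸ hj)
    have hrj : r j = 0 := Function.notMem_support.mp (hrs ▸ hj)
    rw [huj, hrj]

theorem conj_eq_sum (hu : IsMinimalLogicalTriple E s u) (hE : IsPauliEncoding E)
    (hs : s.Nonempty) {U : Fin n → Matrix.unitaryGroup (Fin 2) ℂ}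
    (hU : tensorOp (fun i => U i) * E = E * g) (a : Fin 3) :
    gᴴ * logicalPauli E (u a) * g =
      ∑ b, ((∏ i, pauliTransfer (U i) (u a i) (u b i) : ℝ) : ℂ) • logicalPauli E (u b) := by
  obtain ⟨k, hk⟩ := id hs
  have hinj : Function.Injective u := fun b c hbc =>
    hu.apply_injective hE hk (congrFun hbc k)
  rw [conj_logicalPauli_eq_sum hU]
  refine (Fintype.sum_of_injective u hinj _ _ (fun r hr => ?_) fun _ => rfl).symm
  by_contra! hne
  obtain ⟨hprod, hr0⟩ := smul_ne_zero_iff.mp hne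
  exact hr (hu.mem_range_of_support_eq hE hs
    ((support_eq_of_prod_pauliTransfer_ne_zero (mod_cast hprod)).trans (hu.support_eq a)) hr0)

theorem sum_prod_pauliTransfer_sq [Nonempty κ] (hu : IsMinimalLogicalTriple E s u)
    (hE : IsPauliEncoding E) (hs : s.Nonempty) {U : Fin n → Matrix.unitaryGroup (Fin 2) ℂ}
    (hU : tensorOp (fun i => U i) * E = E * g) (a : Fin 3) :
    ∑ b, (∏ i, pauliTransfer (U i) (u a i) (u b i)) ^ 2 = 1 := by
  have hMM := fun b => hE.logicalPauli_mul_self (hu.ne_zero b)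
  have hunit := IsTransversalGate.conjTranspose_mul_self ⟨U, hU⟩ hE.isometry
  have hsq := conj_mul_conj_self (mul_eq_one_comm.mp hunit) hunit (hMM a)
  have htrace := trace_sum_smul_mul_self (trace_mul_eq_ite_of_anticommute hMM hu.anticommute)
    fun b => ((∏ i, pauliTransfer (U i) (u a i) (u b i) : ℝ) : ℂ)
  rw [← hu.conj_eq_sum hE hs hU, hsq, Matrix.trace_one, eq_comm] at htrace
  exact_mod_cast (mul_eq_right₀ (by simp)).mp htrace

end IsMinimalLogicalTriple

theorem IsPauliEncoding.isMinimalLogicalTriple_xor (hE : IsPauliEncoding E) {q : Fin n → Fin 4}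
    (hmin : ∀ r, pauliWeight r < pauliWeight p →
      logicalPauli E r ∈ ℂ ∙ (1 : Matrix κ κ ℂ))
    (hp : logicalPauli E p ≠ 0) (hq : logicalPauli E q ≠ 0)
    (hqs : Function.support q = Function.support p)
    (hpq : logicalPauli E p * logicalPauli E q = -(logicalPauli E q * logicalPauli E p)) :
    IsMinimalLogicalTriple E (Function.support p) ![p, q, fun i => p i ^^^ q i] := by
  have hxor : ∀ {a b : Fin 4}, a ^^^ b ≠ 0 ↔ a ≠ b := by decide
  have hne : ∀ i, p i ≠ 0 → q i ≠ p i := fun i hi h =>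
    hq (Submodule.disjoint_def.mp (hE.disjoint_span_singleton hq hpq) _
      (hE.mem_span_singleton_of_apply_eq hmin hp hqs hi h) (Submodule.mem_span_singleton_self _))
  have hsupp : Function.support (fun i => p i ^^^ q i) = Function.support p := by
    ext i
    have hi : q i ≠ 0 ↔ p i ≠ 0 := Set.ext_iff.mp hqs i
    rw [Function.mem_support, Function.mem_support, hxor]
    exact ⟨fun h hpi => h (hpi.trans (not_not.mp (mt hi.mp (not_not.mpr hpi))).symm),
      fun h => (hne i h).symm⟩
  obtain ⟨c, hc, hmul⟩ := hE.exists_logicalPauli_xor_eq_smul_mul hq p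
  have hmul0 : logicalPauli E p * logicalPauli E q ≠ 0 := fun h => hp <| by
    rw [← mul_one (logicalPauli E p), ← hE.logicalPauli_mul_self hq, ← mul_assoc, h, zero_mul]
  have hlogical : (fun a => logicalPauli E ((![p, q, fun i => p i ^^^ q i] : Fin 3 → _) a)) =
      ![logicalPauli E p, logicalPauli E q, c • (logicalPauli E p * logicalPauli E q)] := by
    ext1 a
    fin_cases a <;> simp [hmul]
  refine ⟨?_, ?_, ?_, ?_⟩
  · exact Fin.forall_fin_succ.mpr ⟨rfl, Fin.forall_fin_two.mpr ⟨hqs, hsupp⟩⟩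
  · exact Fin.forall_fin_succ.mpr ⟨hp, Fin.forall_fin_two.mpr
      ⟨hq, (hmul.trans_ne (smul_ne_zero hc hmul0) :)⟩⟩
  · intro a b hab
    have h := pairwise_anticommute_of_anticommute hpq c hab
    simpa only [← hlogical] using h
  · rwa [← pauliWeight_eq_ncard_support]

end LogicalPauliTriple

section LogicalQubit

variable {n : ℕ} {E : Matrix (Fin n → Fin 2) (Fin 2) ℂ} {f g : Matrix (Fin 2) (Fin 2) ℂ}
  {p : Fin n → Fin 4} {s : Set (Fin n)} {u : Fin 3 → Fin n → Fin 4}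

theorem IsMinimalLogicalTriple.exists_int_norm_trace_sq (hu : IsMinimalLogicalTriple E s u)
    (hE : IsPauliEncoding E) (hs : s.Nontrivial) (hg : IsTransversalGate E g) :
    ∃ z : ℤ, ‖g.trace‖ ^ 2 = z := by
  have hunit := hg.conjTranspose_mul_self hE.isometry
  obtain ⟨U, hU⟩ := hg
  obtain ⟨i, hi, j, hj, hij⟩ := id hs
  choose z hz using fun a => exists_int_eq_prod_of_sum_sq_eq_one
    (fun k => sum_pauliTransfer_sq (U k) (u a k)) hij (hu.apply_injective hE hi)
    (hu.apply_injective hE hj) (hu.sum_prod_pauliTransfer_sq hE hs.nonempty hU a)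
  have htrace := trace_mul_trace_eq_one_add_sum
    (fun a => hE.logicalPauli_mul_self (hu.ne_zero a)) hu.anticommute hunit
    (hu.conj_eq_sum hE hs.nonempty hU)
  refine ⟨1 + ∑ a, z a a, ?_⟩
  rw [Matrix.trace_conjTranspose, ← starRingEnd_apply, Complex.conj_mul'] at htrace
  simp only [hz] at htrace
  exact_mod_cast htrace

namespace IsPauliEncoding

theorem commute_of_forall_support_eq (hE : IsPauliEncoding E)
    (hp : logicalPauli E p ∉ ℂ ∙ (1 : Matrix (Fin 2) (Fin 2) ℂ))
    (hcomm : ∀ q, Function.support q = Function.support p →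
      logicalPauli E p * logicalPauli E q = logicalPauli E q * logicalPauli E p)
    (hg : IsTransversalGate E g) (hgt : g.trace ≠ 0) :
    g * logicalPauli E p = logicalPauli E p * g := by
  have hp0 : logicalPauli E p ≠ 0 := fun h => hp (h ▸ Submodule.zero_mem _)
  have hunit := mul_eq_one_comm.mp (hg.conjTranspose_mul_self hE.isometry)
  obtain ⟨U, hU⟩ := hg
  refine commute_of_commute_conj (hE.trace_eq_zero_of_notMem_span_one hp)
    (hE.logicalPauli_mul_self hp0) hunit hgt ?_
  rw [conj_logicalPauli_eq_sum hU, Finset.mul_sum, Finset.sum_mul]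
  refine Finset.sum_congr rfl fun r _ => ?_
  by_cases hr : ∏ i, pauliTransfer (U i) (p i) (r i) = 0
  · simp [hr]
  · rw [mul_smul_comm, smul_mul_assoc, hcomm r (support_eq_of_prod_pauliTransfer_ne_zero hr)]

theorem exists_anticommuting (hE : IsPauliEncoding E)
    (hp : logicalPauli E p ∉ ℂ ∙ (1 : Matrix (Fin 2) (Fin 2) ℂ))
    (hf : IsTransversalGate E f) (hg : IsTransversalGate E g) (hft : f.trace ≠ 0)
    (hgt : g.trace ≠ 0) (hfg : f * g ≠ g * f) :
    ∃ q, Function.support q = Function.support p ∧ logicalPauli E q ≠ 0 ∧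
      logicalPauli E p * logicalPauli E q = -(logicalPauli E q * logicalPauli E p) := by
  obtain ⟨q, hqs, hpq⟩ : ∃ q, Function.support q = Function.support p ∧
      logicalPauli E p * logicalPauli E q ≠ logicalPauli E q * logicalPauli E p := by
    by_contra! hcomm
    exact hp (mem_span_one_of_commute_of_not_commute
      (hE.commute_of_forall_support_eq hp hcomm hf hft)
      (hE.commute_of_forall_support_eq hp hcomm hg hgt) hfg)
  exact ⟨q, hqs, fun hq => hpq (by rw [hq, zero_mul, mul_zero]),
    (hE.commute_or_anticommute p q).resolve_left hpq⟩

theorem exists_isMinimalLogicalTriple (hE : IsPauliEncoding E)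
    (hscalar : ∀ q, pauliWeight q < 2 → logicalPauli E q ∈ ℂ ∙ (1 : Matrix (Fin 2) (Fin 2) ℂ))
    (hf : IsTransversalGate E f) (hg : IsTransversalGate E g) (hft : f.trace ≠ 0)
    (hgt : g.trace ≠ 0) (hfg : f * g ≠ g * f) :
    ∃ s u, s.Nontrivial ∧ IsMinimalLogicalTriple E s u := by
  obtain ⟨p, hp, hmin⟩ := (measure (pauliWeight (n := n))).wf.has_min
    {p | logicalPauli E p ∉ ℂ ∙ (1 : Matrix (Fin 2) (Fin 2) ℂ)}
    hE.exists_logicalPauli_notMem_span_one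
  obtain ⟨q, hqs, hq, hpq⟩ := hE.exists_anticommuting hp hf hg hft hgt hfg
  refine ⟨_, _, ?_, hE.isMinimalLogicalTriple_xor (fun r hr => not_not.mp fun h => hmin r h hr)
    (fun h => hp (h ▸ Submodule.zero_mem _)) hq hqs hpq⟩
  rw [← Set.one_lt_ncard_iff_nontrivial, ← pauliWeight_eq_ncard_support]
  exact not_lt.mp (mt (hscalar p) hp)

theorem exists_int_norm_trace_sq (hE : IsPauliEncoding E)
    (hscalar : ∀ q, pauliWeight q < 2 → logicalPauli E q ∈ ℂ ∙ (1 : Matrix (Fin 2) (Fin 2) ℂ))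
    (hf : IsTransversalGate E f) (hg : IsTransversalGate E g) (hft : f.trace ≠ 0)
    (hgt : g.trace ≠ 0) (hfg : f * g ≠ g * f) : ∃ z : ℤ, ‖g.trace‖ ^ 2 = z := by
  obtain ⟨s, u, hs, hu⟩ := hE.exists_isMinimalLogicalTriple hscalar hf hg hft hgt hfg
  exact hu.exists_int_norm_trace_sq hE hs hg

end IsPauliEncoding

end LogicalQubit

section Stabilizer

theorem mul_conjTranspose_mul_of_forall_mulVec_mem_range {R ι κ l : Type*} [CommRing R]
    [StarRing R] [Fintype ι] [Fintype κ] [DecidableEq κ] [Fintype l]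
    {E : Matrix ι κ R} {A : Matrix ι l R} (hE : Eᴴ * E = 1)
    (hA : ∀ v, A *ᵥ v ∈ LinearMap.range E.mulVecLin) : E * (Eᴴ * A) = A := by
  classical
  refine Matrix.ext_of_mulVec_single fun i => ?_
  obtain ⟨w, hw⟩ := hA (Pi.single i 1)
  rw [Matrix.mulVecLin_apply] at hw
  rw [← Matrix.mulVec_mulVec, ← Matrix.mulVec_mulVec, ← hw, Matrix.mulVec_mulVec w, hE,
    Matrix.one_mulVec]

theorem compression_eq_zero_of_anticommute {ι κ : Type*} [Fintype ι] [DecidableEq ι]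
    {E : Matrix ι κ ℂ} {T A : Matrix ι ι ℂ} (hT : Tᴴ * T = 1) (hTE : T * E = E)
    (hTA : T * A = -(A * T)) : Eᴴ * A * E = 0 := by
  have hET : Eᴴ * T = Eᴴ := by
    conv_lhs => rw [← hTE, Matrix.conjTranspose_mul, Matrix.mul_assoc, hT, Matrix.mul_one]
  suffices hneg : Eᴴ * A * E = -(Eᴴ * A * E) from
    Matrix.ext fun i j => self_eq_neg.mp (congrFun (congrFun hneg i) j)
  calc Eᴴ * A * E = Eᴴ * (T * A) * E := by rw [← Matrix.mul_assoc, hET]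
    _ = -(Eᴴ * A * (T * E)) := by simp only [hTA, Matrix.mul_neg, Matrix.neg_mul, Matrix.mul_assoc]
    _ = -(Eᴴ * A * E) := by rw [hTE]

variable {n : ℕ} {C : Submodule ℂ (QubitSpace n)} {κ : Type*} [Fintype κ] [DecidableEq κ]
  {E : Matrix (Fin n → Fin 2) κ ℂ}

theorem IsStabilizerCode.isPauliEncoding (hC : IsStabilizerCode C) (hE : Eᴴ * E = 1)
    (hEC : LinearMap.range E.mulVecLin = C) : IsPauliEncoding E := by
  obtain ⟨S, hS, hSC⟩ := hC
  have hfix : ∀ s ∈ S, (s : Matrix (Fin n → Fin 2) (Fin n → Fin 2) ℂ) * E = E := fun s hs =>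
    Matrix.ext_of_mulVec_single fun i => by
      rw [← Matrix.mulVec_mulVec, (hSC _).mp (hEC ▸ LinearMap.mem_range_self E.mulVecLin _) s hs]
  refine ⟨hE, fun p => ?_⟩
  by_cases hcomm : ∀ s ∈ S, (s : Matrix (Fin n → Fin 2) (Fin n → Fin 2) ℂ) * pauliString p =
      pauliString p * s
  · right
    rw [logicalPauli, Matrix.mul_assoc Eᴴ]
    refine (mul_conjTranspose_mul_of_forall_mulVec_mem_range hE fun v => ?_).symm
    rw [hEC, hSC]
    intro s hs
    rw [Matrix.mulVec_mulVec, ← Matrix.mul_assoc, hcomm s hs, Matrix.mul_assoc, hfix s hs]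
  · left
    push Not at hcomm
    obtain ⟨s, hs, hne⟩ := hcomm
    have hanti : (s : Matrix (Fin n → Fin 2) (Fin n → Fin 2) ℂ) * pauliString p =
        -(pauliString p * s) := by
      obtain ⟨k, q, hkq⟩ := hS s hs
      rw [hkq, Matrix.smul_mul, Matrix.mul_smul] at hne ⊢
      rw [(pauliString_commute_or_anticommute q p).resolve_left fun h => hne (by rw [h]), smul_neg]
    exact compression_eq_zero_of_anticommute s.2.1 (hfix s hs) hanti

theorem IsQuantumCode.logicalPauli_mem_span_one {K d : ℕ} (hC : IsQuantumCode C K d)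
    (hE : Eᴴ * E = 1) (hEC : LinearMap.range E.mulVecLin = C) {p : Fin n → Fin 4}
    (hp : pauliWeight p < d) : logicalPauli E p ∈ ℂ ∙ (1 : Matrix κ κ ℂ) := by
  obtain ⟨c, hc⟩ := hC.detects p hp
  have hcol : ∀ i, E.col i ∈ C := fun i => by
    rw [← hEC, ← Matrix.mulVec_single_one]
    exact LinearMap.mem_range_self E.mulVecLin _
  refine Submodule.mem_span_singleton.mpr ⟨c, ?_⟩
  ext i j
  calc (c • (1 : Matrix κ κ ℂ)) i j = c * (star (E.col i) ⬝ᵥ E.col j) := by rw [← hE]; rfl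
    _ = star (E.col i) ⬝ᵥ (pauliString p *ᵥ E.col j) := (hc _ (hcol i) _ (hcol j)).symm
    _ = logicalPauli E p i j := by rw [logicalPauli, Matrix.mul_assoc]; rfl

end Stabilizer

section NonEntangling

variable {n : ℕ} {W : Matrix (Fin n → Fin 2) (Fin n → Fin 2) ℂ}

namespace IsNonEntangling

theorem conjTranspose_mul_self (hW : IsNonEntangling W) : Wᴴ * W = 1 := by
  obtain ⟨U, σ, rfl⟩ := hW
  exact conjTranspose_mul_self_mul (conjTranspose_tensorOp_mul_self U)
    (conjTranspose_permOp_mul_self σ)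

theorem exists_mul_tensorOp (hW : IsNonEntangling W) (V : Fin n → Matrix.unitaryGroup (Fin 2) ℂ) :
    ∃ V' : Fin n → Matrix.unitaryGroup (Fin 2) ℂ,
      W * tensorOp (fun i => V i) = tensorOp (fun i => V' i) * W := by
  obtain ⟨U, σ, rfl⟩ := hW
  refine ⟨fun i => U i * V (σ i) * (U i)⁻¹, ?_⟩
  rw [Matrix.mul_assoc, permOp_mul_tensorOp, ← Matrix.mul_assoc, ← Matrix.mul_assoc,
    tensorOp_mul, tensorOp_mul]
  congr 2
  ext1 i
  exact congrArg Subtype.val (inv_mul_cancel_right (U i * V (σ i)) (U i)).symm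

theorem conj_pauliString_mem_span (hW : IsNonEntangling W) (p : Fin n → Fin 4) :
    Wᴴ * pauliString p * W ∈
      Submodule.span ℂ (pauliString '' {r | pauliWeight r = pauliWeight p}) := by
  obtain ⟨U, σ, rfl⟩ := hW
  have hconj : (tensorOp (fun i => U i) * permOp σ)ᴴ * pauliString p *
        (tensorOp (fun i => U i) * permOp σ) =
      (permOp σ)ᴴ * ((tensorOp fun i => U i)ᴴ * pauliString p * tensorOp fun i => U i) *
        permOp σ := by
    rw [Matrix.conjTranspose_mul]
    simp only [Matrix.mul_assoc]
  rw [hconj, conj_pauliString_eq_sum, Finset.mul_sum, Finset.sum_mul]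
  refine Submodule.sum_mem _ fun r _ => ?_
  rw [mul_smul_comm, smul_mul_assoc, conj_permOp_pauliString]
  by_cases hr : ∏ i, pauliTransfer (U i) (p i) (r i) = 0
  · simp [hr]
  · refine Submodule.smul_mem _ _ (Submodule.subset_span (Set.mem_image_of_mem _ ?_))
    rw [Set.mem_ofPred_eq, pauliWeight_comp_perm, pauliWeight_eq_ncard_support,
      pauliWeight_eq_ncard_support, support_eq_of_prod_pauliTransfer_ne_zero hr]

variable {κ : Type*} {E : Matrix (Fin n → Fin 2) κ ℂ}

theorem isTransversalGate_mul [Fintype κ] {g : Matrix κ κ ℂ} (hW : IsNonEntangling W)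
    (hg : IsTransversalGate E g) : IsTransversalGate (W * E) g := by
  obtain ⟨V, hV⟩ := hg
  obtain ⟨V', hV'⟩ := hW.exists_mul_tensorOp V
  exact ⟨V', by rw [← Matrix.mul_assoc, ← hV', Matrix.mul_assoc, hV, ← Matrix.mul_assoc]⟩

theorem logicalPauli_mul_mem (hW : IsNonEntangling W) {p : Fin n → Fin 4}
    {S : Submodule ℂ (Matrix κ κ ℂ)}
    (hS : ∀ r, pauliWeight r = pauliWeight p → logicalPauli E r ∈ S) :
    logicalPauli (W * E) p ∈ S := by
  have hcompression : ∀ A : Matrix (Fin n → Fin 2) (Fin n → Fin 2) ℂ,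
      A ∈ Submodule.span ℂ (pauliString '' {r | pauliWeight r = pauliWeight p}) →
        Eᴴ * A * E ∈ S := fun A hA => by
    induction hA using Submodule.span_induction with
    | mem A hA =>
      obtain ⟨r, hr, rfl⟩ := hA
      exact hS r hr
    | zero => simp
    | add A B _ _ hA hB => simpa only [Matrix.mul_add, Matrix.add_mul] using S.add_mem hA hB
    | smul c A _ hA => simpa only [Matrix.mul_smul, Matrix.smul_mul] using S.smul_mem c hA
  have h := hcompression _ (hW.conj_pauliString_mem_span p)
  rw [logicalPauli, Matrix.conjTranspose_mul]
  simpa only [Matrix.mul_assoc] using h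

end IsNonEntangling

end NonEntangling

section BinaryIcosahedral

theorem trace_gateF : (gateF : Matrix (Fin 2) (Fin 2) ℂ).trace = 1 := by
  have htrace : (gateF : Matrix (Fin 2) (Fin 2) ℂ).trace =
      (1 - Complex.I) / 2 * (1 + Complex.I) := by
    simp [gateF, Matrix.trace_fin_two, mul_add]
  rw [htrace]
  linear_combination -Complex.I_sq / 2

theorem trace_gatePhi : (gatePhi : Matrix (Fin 2) (Fin 2) ℂ).trace = (Real.goldenRatio : ℂ) := by
  simp [gatePhi, Matrix.trace_fin_two]
  ring

theorem gateF_mul_gatePhi_ne : gateF * gatePhi ≠ gatePhi * gateF := by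
  intro h
  have hentry : (1 - Complex.I) / 2 * Complex.I * 2⁻¹ = (1 - Complex.I) / 2 * 2⁻¹ := by
    simpa [gateF, gatePhi, mul_comm _ ((1 - Complex.I) / 2)] using
      congrFun (congrFun (congrArg Subtype.val h) 0) 0
  exact Complex.I_ne_zero (by linear_combination 2 * hentry + Complex.I_sq / 2)

theorem goldenRatio_sq_ne_intCast (z : ℤ) : Real.goldenRatio ^ 2 ≠ z := fun h =>
  Real.goldenRatio_irrational.ne_int (z - 1) <| by
    rw [Int.cast_sub, ← h, Real.goldenRatio_sq]
    simp

theorem IsBinaryIcosahedral.exists_not_commute_trace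
    {G : Subgroup (Matrix.specialUnitaryGroup (Fin 2) ℂ)} (hG : IsBinaryIcosahedral G) :
    ∃ f ∈ G, ∃ g ∈ G, f * g ≠ g * f ∧ (f : Matrix (Fin 2) (Fin 2) ℂ).trace = 1 ∧
      (g : Matrix (Fin 2) (Fin 2) ℂ).trace = (Real.goldenRatio : ℂ) := by
  obtain ⟨h, rfl⟩ := hG
  have htrace : ∀ u : Matrix.specialUnitaryGroup (Fin 2) ℂ,
      (MulAut.conj h u : Matrix (Fin 2) (Fin 2) ℂ).trace =
        (u : Matrix (Fin 2) (Fin 2) ℂ).trace := fun u => by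
    have hu : h⁻¹ * (h * u) = u := inv_mul_cancel_left h u
    exact (Matrix.trace_mul_comm _ _).trans (congrArg (fun v => Matrix.trace v.1) hu)
  refine ⟨_, Subgroup.mem_map_of_mem _ (Subgroup.subset_closure (by simp : gateF ∈ _)),
    _, Subgroup.mem_map_of_mem _ (Subgroup.subset_closure (by simp : gatePhi ∈ _)), ?_,
    (htrace _).trans trace_gateF, (htrace _).trans trace_gatePhi⟩
  rw [← map_mul, ← map_mul]
  exact (MulAut.conj h).injective.ne gateF_mul_gatePhi_ne

end BinaryIcosahedral

theorem mainTheorem3_general {n K d : ℕ} (hd : 2 ≤ d) {C : Submodule ℂ (QubitSpace n)}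
    (hC : IsQuantumCode C K d) {G : Subgroup (Matrix.specialUnitaryGroup (Fin 2) ℂ)}
    (hCG : ImplementsTransversally C G) {f g : Matrix.specialUnitaryGroup (Fin 2) ℂ}
    (hf : f ∈ G) (hg : g ∈ G) (hfg : f * g ≠ g * f)
    (hft : (f : Matrix (Fin 2) (Fin 2) ℂ).trace ≠ 0)
    (hgt : ∀ z : ℤ, ‖(g : Matrix (Fin 2) (Fin 2) ℂ).trace‖ ^ 2 ≠ z) : IsNonAdditive C := by
  rintro ⟨C', hC', W, hW, hCC'⟩
  obtain ⟨E, ⟨hE, hEC⟩, hEG⟩ := hCG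
  have hWE : IsPauliEncoding (W * E) :=
    hC'.isPauliEncoding (conjTranspose_mul_self_mul hW.conjTranspose_mul_self hE)
      (by rw [Matrix.mulVecLin_mul, LinearMap.range_comp, hEC, hCC'])
  have hscalar : ∀ p, pauliWeight p < 2 →
      logicalPauli (W * E) p ∈ ℂ ∙ (1 : Matrix (Fin 2) (Fin 2) ℂ) := fun p hp =>
    hW.logicalPauli_mul_mem fun r hr =>
      hC.logicalPauli_mem_span_one hE hEC (hr.trans_lt (hp.trans_le hd))
  have hgt0 : (g : Matrix (Fin 2) (Fin 2) ℂ).trace ≠ 0 := fun h => hgt 0 (by simp [h])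
  obtain ⟨z, hz⟩ := hWE.exists_int_norm_trace_sq hscalar (hW.isTransversalGate_mul (hEG f hf))
    (hW.isTransversalGate_mul (hEG g hg)) hft hgt0 (Subtype.coe_injective.ne hfg)
  exact hgt z hz

theorem mainTheorem3 (n d : ℕ) (hd : 2 ≤ d) (C : Submodule ℂ (QubitSpace n))
    (hC : IsQuantumCode C 2 d)
    (G : Subgroup (Matrix.specialUnitaryGroup (Fin 2) ℂ)) (hG : IsBinaryIcosahedral G)
    (hCG : ImplementsTransversally C G) :
    IsNonAdditive C := by
  obtain ⟨f, hf, g, hg, hfg, hft, hgt⟩ := hG.exists_not_commute_trace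
  exact mainTheorem3_general hd hC hCG hf hg hfg (by simp [hft]) fun z => by
    rw [hgt, Complex.norm_real, Real.norm_eq_abs, sq_abs]
    exact goldenRatio_sq_ne_intCast z
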